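/- Let $T$ be a rooted tree with $n \ge 1$ nodes labelled $1,\dots,n$ and root $r$; write $\mathcal C(i)$ for the set of children of node $i$, and let the height $h$ of $T$ be the maximal graph distance from the root to a leaf. For $V\in\mathbb R$ let $$\mathcal F_{T,V}=\Bigl\{\mu\in\mathbb R^n:\ \mu_i\ge \sum_{j\in\mathcal C(i)}\mu_j\ \text{ for all } i=1,\dots,n,\ \text{ and } \mu_r\le V\Bigr\}$$ be the set of flows on $T$ with root flow at most $V$ (the sum over the empty set at a leaf is $0$, so flows are nonnegative). For $\sigma>0$ we observe $Y_i=\mu_i+\epsilon_i$, $i=1,\dots,n$, with $\epsilon_1,\dots,\epsilon_n$ independent $N(0,\sigma^2)$. Let $$R(T,V,\sigma)=\inf_{\tilde\mu}\ \sup_{\mu\in\mathcal F_{T,V}}\ \mathbb E_\mu\,\frac1n\|\tilde\mu(Y)-\mu\|^2\in[0,\infty],$$ where $\|\cdot\|$ is the Euclidean norm and the infimum is over all measurable $\tilde\mu:\mathbb R^n\to\mathbb R^n$ (which may depend on $T$, $V$, $\sigma$). **Theorem.** There is a universal constant $c>0$, and for every $\epsilon>0$ there is a constant $c_\epsilon>0$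 depending only on $\epsilon$, such that for every $C\in\mathbb N$, every rooted tree $T$ with $n$ nodes and height $h\le C$, every $\sigma>0$ and every $V$, $$R(T,V,\sigma)\ \ge\ \begin{cases} c\,\dfrac{V^2}{n} & \text{if } 0<V\le\sigma\sqrt{\log n},\\[2mm] c_\epsilon\, V\sigma\,\dfrac{\sqrt{\log n}}{n} & \text{if } \sigma\sqrt{\log n}<V\le\sigma n^{1-\epsilon},\\[2mm] c\,\sigma^2 & \text{if } V>n\sigma. \end{cases}$$ In particular the constants depend neither on $n$, $T$, $V$, $\sigma$ nor on the bound $C$ on the height. -/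

import Mathlib

open MeasureTheory ProbabilityTheory

namespace TreeFlow

/-- The children of the node `i` in the tree `G` rooted at `r`: the neighbours of `i` that are
one step further away from the root. -/
noncomputable def children {n : ℕ} (G : SimpleGraph (Fin n)) (r i : Fin n) : Finset (Fin n) :=
  open Classical in Finset.univ.filter (fun j => G.Adj i j ∧ G.dist r j = G.dist r i + 1)

/-- The height of the tree `G` rooted at `r`: the largest graph distance from the root to a node
(equivalently, to a leaf, since a node at maximal distance from the root has no children). -/
noncomputable def height {n : ℕ} (G : SimpleGraph (Fin n)) (r : Fin n) : ℕ :=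
  Finset.univ.sup (fun i => G.dist r i)

/-- The flows on the tree `G` rooted at `r`: the value at each node is at least the sum of the
values at its children. At a leaf the sum is empty, so all values are nonnegative. -/
def flows {n : ℕ} (G : SimpleGraph (Fin n)) (r : Fin n) : Set (Fin n → ℝ) :=
  {μ | ∀ i, ∑ j ∈ children G r i, μ j ≤ μ i}

/-- The flows whose value at the root is at most `V`. -/
def boundedFlows {n : ℕ} (G : SimpleGraph (Fin n)) (r : Fin n) (V : ℝ) : Set (Fin n → ℝ) :=
  {μ | μ ∈ flows G r ∧ μ r ≤ V}

/-- The law of the observation `Y`, with independent coordinates `Y i ∼ N(μ i, σ ^ 2)`. -/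
noncomputable def obsLaw {n : ℕ} (σ : ℝ) (μ : Fin n → ℝ) : Measure (Fin n → ℝ) :=
  Measure.pi (fun i => gaussianReal (μ i) (σ ^ 2).toNNReal)

/-- The squared error loss `(1 / n) ‖a - b‖ ^ 2`, for the Euclidean norm. -/
noncomputable def loss {n : ℕ} (a b : Fin n → ℝ) : ℝ :=
  (1 / (n : ℝ)) * ∑ i, (a i - b i) ^ 2

/-- The risk of the estimator `est` at `μ`: the expected loss, as an extended nonnegative real
(it is `∞` when the loss has no finite expectation). -/
noncomputable def risk {n : ℕ} (σ : ℝ) (est : (Fin n → ℝ) → (Fin n → ℝ)) (μ : Fin n → ℝ) :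
    ENNReal :=
  ∫⁻ y, ENNReal.ofReal (loss (est y) μ) ∂(obsLaw σ μ)

/-- The minimax risk over the parameter set `Θ`: the infimum over all estimators (measurable
functions of the observation) of the worst-case risk over `Θ`. -/
noncomputable def minimaxRisk {n : ℕ} (σ : ℝ) (Θ : Set (Fin n → ℝ)) : ENNReal :=
  ⨅ (est : (Fin n → ℝ) → (Fin n → ℝ)) (_ : Measurable est), ⨆ μ ∈ Θ, risk σ est μ

end TreeFlow

/-! Sending an amount `a` of flow from the root to a node `x` adds `a` at every ancestor of `x`, so
two such flows are at squared distance `a ^ 2` times the number of nodes above exactly one of the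
endpoints (`separators`). The proof tests between many flows of this kind at once, in separate
regions of the tree.

The regions are the blocks of `m` consecutive nodes in depth first order. A subtree is an interval
in this order, so it splits at most two blocks (`card_filter_mem_cut_le`). Moving an endpoint inside
its block only changes nodes whose subtree splits the block. Hence the blocks give nearly
independent testing problems, whose errors add up to a factor 2 (`minimaxRisk_ge_of_product`), and
the cut sizes sum to at most `2 * n`.

In one block, a multiscale packing argument (`exists_separated_in_ball`) gives a scale `D` and a set
`P` that is `D / 2`-separated, lies in a ball of radius `D`, and satisfies `log m ≤ 2 * D * log
|P|`. A Fano type bound allows an amplitude with `a ^ 2 * D` of order `τ ^ 2 * log |P|` for any `τ ≤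
σ`. The entropy inequality then gives `a ≥ τ * √(log m) / (4 * D)`, so the squared error of a block
is at least of order `τ * √(log m) * a`: the error per unit of flow is `τ * √(log m)`, whatever the
shape of the tree. Using blocks until the flow `V` is nearly spent gives risk of order `V * τ *
√(log m) / n`. Since `D` is at most twice the cut size, and cut sizes average at most `2 * n / (n /
m)`, the blocks can absorb flow of order `τ * √(log m) * (n / m) ^ 2 / n`. Taking `m` near `n ^ (ε /
2)` covers `V ≤ τ * n ^ (1 - ε)`.

The middle regime is `τ = σ`, and the small one is `τ = V / √(log n)`. Small `n` is settled by two
hypotheses at the root, and large `V` by independent perturbations at all nodes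
(`minimaxRisk_ge_of_cube`). -/

namespace TreeFlow

/-! ### Gaussian change of measure -/

section Gaussian

open scoped ENNReal NNReal

/-- The likelihood ratio of `N(a, v)` with respect to `N(b, v)`. -/
noncomputable def gaussianRatio (v : ℝ≥0) (a b x : ℝ) : ℝ≥0∞ :=
  ENNReal.ofReal (Real.exp ((a - b) / v * x + (b ^ 2 - a ^ 2) / (2 * v)))

lemma measurable_gaussianRatio (v : ℝ≥0) (a b : ℝ) : Measurable (gaussianRatio v a b) := by
  unfold gaussianRatio
  fun_prop

lemma gaussianReal_withDensity_gaussianRatio {v : ℝ≥0} (hv : v ≠ 0) (a b : ℝ) :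
    (gaussianReal b v).withDensity (gaussianRatio v a b) = gaussianReal a v := by
  have hv' : (v : ℝ) ≠ 0 := by exact_mod_cast hv
  rw [gaussianReal_of_var_ne_zero _ hv, gaussianReal_of_var_ne_zero _ hv,
    ← withDensity_mul _ (measurable_gaussianPDF b v) (measurable_gaussianRatio v a b)]
  congr 1
  ext x
  rw [Pi.mul_apply, gaussianPDF, gaussianPDF, gaussianRatio,
    ← ENNReal.ofReal_mul (gaussianPDFReal_nonneg _ _ _)]
  congr 1
  rw [gaussianPDFReal, gaussianPDFReal, mul_assoc, ← Real.exp_add]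
  congr 2
  field_simp
  ring

/-- The square of the ratio is again an exponential in `x`, so this is a value of the Gaussian
moment generating function. It is one plus the chi-square divergence. -/
lemma lintegral_gaussianRatio_sq {v : ℝ≥0} (hv : v ≠ 0) (a b : ℝ) :
    ∫⁻ x, gaussianRatio v a b x ^ 2 ∂(gaussianReal b v) =
      ENNReal.ofReal (Real.exp ((a - b) ^ 2 / v)) := by
  have hv' : (v : ℝ) ≠ 0 := by exact_mod_cast hv
  have h : ∀ x, gaussianRatio v a b x ^ 2 = ENNReal.ofReal (Real.exp ((b ^ 2 - a ^ 2) / v)) *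
      ENNReal.ofReal (Real.exp (2 * ((a - b) / v) * x)) := by
    intro x
    rw [gaussianRatio, ← ENNReal.ofReal_pow (Real.exp_nonneg _), ← Real.exp_nat_mul,
      ← ENNReal.ofReal_mul (Real.exp_nonneg _), ← Real.exp_add]
    congr 2
    push_cast
    field_simp
    ring
  simp_rw [h]
  rw [lintegral_const_mul _ (by fun_prop), ← ofReal_integral_eq_lintegral_ofReal
    (integrable_exp_mul_gaussianReal _) (Filter.Eventually.of_forall fun x => Real.exp_nonneg _)]
  have := congrFun (mgf_id_gaussianReal (μ := b) (v := v)) (2 * ((a - b) / v))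
  rw [mgf] at this
  simp only [id] at this
  rw [this, ← ENNReal.ofReal_mul (Real.exp_nonneg _), ← Real.exp_add]
  congr 2
  field_simp
  ring

lemma lintegral_pi_prod {ι : Type*} [Fintype ι] (P : ι → Measure ℝ)
    [∀ i, IsProbabilityMeasure (P i)] {f : ι → ℝ → ℝ≥0∞} (hf : ∀ i, Measurable (f i)) :
    ∫⁻ y, ∏ i, f i (y i) ∂(Measure.pi P) = ∏ i, ∫⁻ x, f i x ∂(P i) := by
  have hX : iIndepFun (fun i (y : ι → ℝ) => f i (y i)) (Measure.pi P) :=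
    iIndepFun_pi fun i => (hf i).aemeasurable
  rw [lintegral_prod_eq_prod_lintegral_of_indepFun Finset.univ (fun i (y : ι → ℝ) => f i (y i))
    hX fun i => (hf i).comp (measurable_pi_apply i)]
  refine Finset.prod_congr rfl fun i _ => ?_
  exact (measurePreserving_eval P i).lintegral_comp (hf i)

lemma pi_withDensity {ι : Type*} [Fintype ι] (P : ι → Measure ℝ)
    [∀ i, IsProbabilityMeasure (P i)] {f : ι → ℝ → ℝ≥0∞} (hf : ∀ i, Measurable (f i))
    [∀ i, SigmaFinite ((P i).withDensity (f i))] :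
    (Measure.pi P).withDensity (fun y => ∏ i, f i (y i)) =
      Measure.pi (fun i => (P i).withDensity (f i)) := by
  symm
  refine Measure.pi_eq fun s hs => ?_
  rw [withDensity_apply _ (MeasurableSet.univ_pi hs),
    ← lintegral_indicator (MeasurableSet.univ_pi hs)]
  have : ∀ y : ι → ℝ, (Set.univ.pi s).indicator (fun y => ∏ i, f i (y i)) y =
      ∏ i, (s i).indicator (f i) (y i) := by
    intro y
    by_cases hy : y ∈ Set.univ.pi s
    · rw [Set.indicator_of_mem hy]
      exact Finset.prod_congr rfl fun i _ =>
        (Set.indicator_of_mem (hy i (Set.mem_univ i)) _).symm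
    · rw [Set.indicator_of_notMem hy]
      simp only [Set.mem_pi, Set.mem_univ, true_implies, not_forall] at hy
      obtain ⟨i, hi⟩ := hy
      exact (Finset.prod_eq_zero (Finset.mem_univ i) (Set.indicator_of_notMem hi _)).symm
  simp_rw [this]
  rw [lintegral_pi_prod P fun i => (hf i).indicator (hs i)]
  refine Finset.prod_congr rfl fun i _ => ?_
  rw [withDensity_apply _ (hs i), lintegral_indicator (hs i)]

instance {n : ℕ} (σ : ℝ) (μ : Fin n → ℝ) : IsProbabilityMeasure (obsLaw σ μ) := by
  unfold obsLaw
  infer_instance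

/-- A change of measure bound: the square of the probability of an event under one Gaussian
product law is controlled by its probability under another. -/
lemma obsLaw_real_sq_le {n : ℕ} {σ : ℝ} (hσ : 0 < σ) (μ ν : Fin n → ℝ) {B : Set (Fin n → ℝ)}
    (hB : MeasurableSet B) :
    (obsLaw σ μ).real B ^ 2 ≤
      Real.exp ((∑ i, (μ i - ν i) ^ 2) / σ ^ 2) * (obsLaw σ ν).real B := by
  set v : ℝ≥0 := (σ ^ 2).toNNReal with hv_def
  have hv : v ≠ 0 := by simp [hv_def, hσ.ne']
  have hvr : (v : ℝ) = σ ^ 2 := Real.coe_toNNReal _ (sq_nonneg σ)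
  have hm := fun i : Fin n => measurable_gaussianRatio v (μ i) (ν i)
  have hsf : ∀ i, SigmaFinite ((gaussianReal (ν i) v).withDensity
      (gaussianRatio v (μ i) (ν i))) := by
    intro i
    rw [gaussianReal_withDensity_gaussianRatio hv]
    infer_instance
  set L : (Fin n → ℝ) → ℝ≥0∞ := fun y => ∏ i, gaussianRatio v (μ i) (ν i) (y i) with hL
  have hLm : Measurable L := by
    refine Finset.measurable_fun_prod _ fun i _ => (hm i).comp (measurable_pi_apply i)
  have hlaw : obsLaw σ μ = (obsLaw σ ν).withDensity L := by
    rw [obsLaw, obsLaw, ← hv_def, pi_withDensity _ hm]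
    congr 1
    ext1 i
    rw [gaussianReal_withDensity_gaussianRatio hv]
  have hsq : ∫⁻ y, L y ^ 2 ∂(obsLaw σ ν) =
      ENNReal.ofReal (Real.exp ((∑ i, (μ i - ν i) ^ 2) / σ ^ 2)) := by
    simp_rw [hL, ← Finset.prod_pow]
    rw [obsLaw, ← hv_def, lintegral_pi_prod (f := fun i x => gaussianRatio v (μ i) (ν i) x ^ 2) _
      (fun i => (hm i).pow_const 2)]
    simp_rw [lintegral_gaussianRatio_sq hv]
    rw [← ENNReal.ofReal_prod_of_nonneg (fun i _ => Real.exp_nonneg _), ← Real.exp_sum, hvr,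
      Finset.sum_div]
  -- Cauchy–Schwarz applied to the likelihood ratio times the indicator of `B`, under the law with
  -- mean `ν`.
  have hCS := ENNReal.lintegral_mul_le_Lp_mul_Lq (obsLaw σ ν)
    (Real.HolderConjugate.two_two) hLm.aemeasurable
    ((measurable_const (a := (1 : ℝ≥0∞))).indicator hB).aemeasurable
  have h1 : ∫⁻ y, (L * B.indicator (fun _ => (1 : ℝ≥0∞))) y ∂(obsLaw σ ν) = obsLaw σ μ B := by
    rw [hlaw, withDensity_apply _ hB, ← lintegral_indicator hB]
    refine lintegral_congr fun y => ?_
    by_cases hy : y ∈ B <;> simp [hy]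
  have h2 : ∫⁻ y, (B.indicator (fun _ => (1 : ℝ≥0∞)) y) ^ (2 : ℝ) ∂(obsLaw σ ν) =
      obsLaw σ ν B := by
    rw [← lintegral_indicator_one hB]
    refine lintegral_congr fun y => ?_
    by_cases hy : y ∈ B <;> simp [hy]
  simp only [ENNReal.rpow_two] at hCS h2
  rw [h1, hsq, h2] at hCS
  have hCS2 : (obsLaw σ μ B) ^ 2 ≤
      ENNReal.ofReal (Real.exp ((∑ i, (μ i - ν i) ^ 2) / σ ^ 2)) * obsLaw σ ν B := by
    calc (obsLaw σ μ B) ^ 2 ≤ _ := pow_le_pow_left' hCS 2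
      _ = _ := by
        rw [mul_pow, ← ENNReal.rpow_natCast, ← ENNReal.rpow_natCast, ← ENNReal.rpow_mul,
          ← ENNReal.rpow_mul]
        norm_num
  have := ENNReal.toReal_mono (by finiteness) hCS2
  rwa [ENNReal.toReal_pow, ENNReal.toReal_mul, ENNReal.toReal_ofReal (Real.exp_nonneg _)] at this

end Gaussian

/-! ### Fano type bound and its product form -/

section Testing

open scoped ENNReal

/-- The squared error restricted to the coordinates in `U`. -/
noncomputable def partialLoss {n : ℕ} (U : Finset (Fin n)) (a b : Fin n → ℝ) : ℝ :=
  ∑ v ∈ U, (a v - b v) ^ 2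

lemma partialLoss_nonneg {n : ℕ} (U : Finset (Fin n)) (a b : Fin n → ℝ) : 0 ≤ partialLoss U a b :=
  Finset.sum_nonneg fun _ _ => sq_nonneg _

lemma partialLoss_le_two_mul_add {n : ℕ} (U : Finset (Fin n)) (a b y : Fin n → ℝ) :
    partialLoss U a b ≤ 2 * partialLoss U y a + 2 * partialLoss U y b := by
  unfold partialLoss
  rw [Finset.mul_sum, Finset.mul_sum, ← Finset.sum_add_distrib]
  exact Finset.sum_le_sum fun v _ => by nlinarith [sq_nonneg (y v - a v + (y v - b v))]

lemma measurable_partialLoss {n : ℕ} (U : Finset (Fin n)) {est : (Fin n → ℝ) → (Fin n → ℝ)}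
    (hest : Measurable est) (b : Fin n → ℝ) : Measurable fun y => partialLoss U (est y) b := by
  unfold partialLoss
  refine Finset.measurable_fun_sum _ fun v _ => ?_
  exact (((measurable_pi_apply v).comp hest).sub_const _).pow_const 2

/-- If the squares of `N ≥ 2` numbers sum to at most `√N`, then their sum is at most `7 N / 8`. -/
lemma sum_le_of_sum_sq_le_sqrt_card {α : Type*} (P : Finset α) (hN : 2 ≤ P.card) (p : α → ℝ)
    (hp : ∑ i ∈ P, p i ^ 2 ≤ √(P.card : ℝ)) : ∑ i ∈ P, p i ≤ 7 / 8 * P.card := by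
  have hN' : (2 : ℝ) ≤ P.card := by exact_mod_cast hN
  have h1 : (∑ i ∈ P, p i) ^ 2 ≤ P.card * ∑ i ∈ P, p i ^ 2 := sq_sum_le_card_mul_sum_sq
  set s := √(P.card : ℝ) with hs
  have hss : s ^ 2 = P.card := Real.sq_sqrt (by linarith)
  -- `s ^ 3 ≤ (7 / 8) ^ 2 * s ^ 4` needs `s ≥ 64 / 49`, which `√2 > 7 / 5` provides.
  have hs1 : (7 / 5 : ℝ) ≤ s := Real.le_sqrt_of_sq_le (by norm_num; linarith)
  refine abs_le_of_sq_le_sq' ?_ (by positivity) |>.2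
  calc (∑ i ∈ P, p i) ^ 2 ≤ P.card * s := h1.trans (by gcongr)
    _ = s ^ 3 := by rw [← hss]; ring
    _ ≤ (7 / 8 * P.card) ^ 2 := by
        rw [← hss]
        nlinarith [pow_pos (show (0 : ℝ) < s by linarith) 3]

/-- Fano type bound: if the `N` means in `P` are within squared distance `σ ^ 2 log N / 2` of a
reference point and are separated on `U`, then they cannot all be estimated well on `U`. -/
lemma sum_lintegral_partialLoss_ge {n : ℕ} {α : Type*} {σ : ℝ} (hσ : 0 < σ) (P : Finset α)
    (hN : 2 ≤ P.card) (μ : α → Fin n → ℝ) (ν : Fin n → ℝ)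
    (hclose : ∀ i ∈ P, ∑ v, (μ i v - ν v) ^ 2 ≤ σ ^ 2 * Real.log P.card / 2)
    (U : Finset (Fin n)) {δ : ℝ} (hδ : 0 ≤ δ)
    (hsep : ∀ i ∈ P, ∀ j ∈ P, i ≠ j → δ ≤ partialLoss U (μ i) (μ j))
    {est : (Fin n → ℝ) → (Fin n → ℝ)} (hest : Measurable est) :
    ENNReal.ofReal (P.card * (δ / 32)) ≤
      ∑ i ∈ P, ∫⁻ y, ENNReal.ofReal (partialLoss U (est y) (μ i)) ∂(obsLaw σ (μ i)) := by
  have hN' : (2 : ℝ) ≤ P.card := by exact_mod_cast hN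
  -- The events that hypothesis `i` is estimated well. Separation by `δ` makes them disjoint, so
  -- their probabilities under the reference law sum to at most 1.
  set B : α → Set (Fin n → ℝ) := fun i => {y | partialLoss U (est y) (μ i) < δ / 4} with hB
  have hBm : ∀ i, MeasurableSet (B i) := fun i =>
    measurableSet_lt (measurable_partialLoss U hest _) measurable_const
  have hdisj : Set.PairwiseDisjoint (P : Set α) B := by
    intro i hi j hj hij
    refine Set.disjoint_left.2 fun y hy hy' => ?_
    have h1 := hsep i hi j hj hij
    have h2 := partialLoss_le_two_mul_add U (μ i) (μ j) (est y)
    simp only [hB, Set.mem_ofPred_eq] at hy hy'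
    linarith
  have hq : ∑ i ∈ P, (obsLaw σ ν).real (B i) ≤ 1 := by
    rw [← measureReal_biUnion_finset hdisj fun i _ => hBm i]
    exact measureReal_le_one
  have hp : ∑ i ∈ P, (obsLaw σ (μ i)).real (B i) ≤ 7 / 8 * P.card := by
    refine sum_le_of_sum_sq_le_sqrt_card P hN _ ?_
    have hexp : ∀ i ∈ P, (obsLaw σ (μ i)).real (B i) ^ 2 ≤
        √(P.card : ℝ) * (obsLaw σ ν).real (B i) := by
      intro i hi
      refine (obsLaw_real_sq_le hσ (μ i) ν (hBm i)).trans ?_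
      gcongr
      -- The closeness radius is tuned so that the change of measure costs exactly a factor `√N`.
      rw [Real.sqrt_eq_rpow, Real.rpow_def_of_pos (by linarith)]
      refine Real.exp_le_exp.2 ?_
      rw [div_le_iff₀ (by positivity)]
      linarith [hclose i hi]
    calc _ ≤ ∑ i ∈ P, √(P.card : ℝ) * (obsLaw σ ν).real (B i) := Finset.sum_le_sum hexp
      _ = √(P.card : ℝ) * ∑ i ∈ P, (obsLaw σ ν).real (B i) := by rw [Finset.mul_sum]
      _ ≤ _ := mul_le_of_le_one_right (Real.sqrt_nonneg _) hq
  have hone : ∀ i, ENNReal.ofReal (δ / 4 * (1 - (obsLaw σ (μ i)).real (B i))) ≤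
      ∫⁻ y, ENNReal.ofReal (partialLoss U (est y) (μ i)) ∂(obsLaw σ (μ i)) := by
    intro i
    have h := mul_meas_ge_le_lintegral₀ (μ := obsLaw σ (μ i))
      (measurable_partialLoss U hest (μ i)).ennreal_ofReal.aemeasurable (ENNReal.ofReal (δ / 4))
    refine le_trans ?_ h
    rw [ENNReal.ofReal_mul (by positivity)]
    gcongr
    rw [← probReal_compl_eq_one_sub (hBm i), ofReal_measureReal]
    refine measure_mono fun y hy => ?_
    simp only [hB, Set.mem_compl_iff, Set.mem_ofPred_eq, not_lt] at hy
    exact ENNReal.ofReal_le_ofReal hy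
  calc ENNReal.ofReal (P.card * (δ / 32))
      ≤ ENNReal.ofReal (∑ i ∈ P, δ / 4 * (1 - (obsLaw σ (μ i)).real (B i))) := by
        refine ENNReal.ofReal_le_ofReal ?_
        -- On average each hypothesis fails with probability at least `1 / 8`, at cost `δ / 4`.
        rw [← Finset.mul_sum, Finset.sum_sub_distrib]
        simp only [Finset.sum_const, nsmul_eq_mul, mul_one]
        nlinarith
    _ = ∑ i ∈ P, ENNReal.ofReal (δ / 4 * (1 - (obsLaw σ (μ i)).real (B i))) :=
        ENNReal.ofReal_sum_of_nonneg fun i _ =>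
          mul_nonneg (by positivity) (sub_nonneg.2 measureReal_le_one)
    _ ≤ _ := Finset.sum_le_sum fun i _ => hone i

/-- Resampling one coordinate preserves the uniform average over a product of finite sets. -/
lemma sum_piFinset_sum_update {ι α R : Type*} [Fintype ι] [DecidableEq ι] [DecidableEq α]
    [AddCommMonoid R] (P : ι → Finset α) (g : ι) (f : (ι → α) → R) :
    ∑ x ∈ Fintype.piFinset P, ∑ i ∈ P g, f (Function.update x g i) =
      (P g).card • ∑ x ∈ Fintype.piFinset P, f x := by
  rw [← Finset.sum_nsmul]
  simp_rw [← Finset.sum_const]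
  rw [← Finset.sum_product', ← Finset.sum_product']
  have hmem : ∀ p ∈ Fintype.piFinset P ×ˢ P g,
      (Function.update p.1 g p.2, p.1 g) ∈ Fintype.piFinset P ×ˢ P g := by
    rintro ⟨x, i⟩ hx
    simp only [Finset.mem_product, Fintype.mem_piFinset] at hx ⊢
    refine ⟨fun h => ?_, hx.1 g⟩
    by_cases hh : h = g
    · subst hh
      simpa using hx.2
    · simpa [hh] using hx.1 h
  -- Exchanging the old and the new value of coordinate `g` is an involution.
  refine Finset.sum_nbij' (fun p => (Function.update p.1 g p.2, p.1 g))
    (fun p => (Function.update p.1 g p.2, p.1 g)) hmem hmem ?_ ?_ ?_ <;> simp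

/-- The minimax risk is bounded below by the contributions of a product family of hypotheses,
if every coordinate is used by at most two of the factors. -/
theorem minimaxRisk_ge_of_product {n : ℕ} {ι α : Type*} [Fintype ι] [DecidableEq ι]
    [DecidableEq α] {σ : ℝ} (hσ : 0 < σ) {Θ : Set (Fin n → ℝ)} (P : ι → Finset α)
    (hN : ∀ g, 2 ≤ (P g).card) (M : (ι → α) → Fin n → ℝ)
    (hM : ∀ x ∈ Fintype.piFinset P, M x ∈ Θ) (c : ι → α)
    (hclose : ∀ x ∈ Fintype.piFinset P, ∀ g, ∀ i ∈ P g,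
      ∑ v, (M (Function.update x g i) v - M (Function.update x g (c g)) v) ^ 2 ≤
        σ ^ 2 * Real.log (P g).card / 2)
    (U : ι → Finset (Fin n)) {δ : ι → ℝ} (hδ : ∀ g, 0 ≤ δ g)
    (hsep : ∀ x ∈ Fintype.piFinset P, ∀ g, ∀ i ∈ P g, ∀ j ∈ P g, i ≠ j →
      δ g ≤ partialLoss (U g) (M (Function.update x g i)) (M (Function.update x g j)))
    (hU : ∀ v, (Finset.univ.filter fun g => v ∈ U g).card ≤ 2) :
    ENNReal.ofReal ((∑ g, δ g) / 64 / n) ≤ minimaxRisk σ Θ := by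
  rcases Nat.eq_zero_or_pos n with hn | hn
  · simp [hn]
  have hn' : (0 : ℝ) < n := by exact_mod_cast hn
  refine le_iInf₂ fun est hest => ?_
  set R := ⨆ μ ∈ Θ, risk σ est μ with hR
  set X := Fintype.piFinset P with hX
  have hXpos : X.card ≠ 0 := by
    rw [hX, Fintype.card_piFinset]
    exact Finset.prod_ne_zero_iff.2 fun g _ => by have := hN g; omega
  set J : ι → (ι → α) → ℝ≥0∞ := fun g x =>
    ∫⁻ y, ENNReal.ofReal (partialLoss (U g) (est y) (M x)) ∂(obsLaw σ (M x)) with hJ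
  have hrisk : ∀ x, ∑ g, J g x ≤ ENNReal.ofReal (2 * n) * risk σ est (M x) := by
    intro x
    rw [risk, hJ, ← lintegral_finsetSum _ fun g _ =>
      (measurable_partialLoss (U g) hest (M x)).ennreal_ofReal]
    rw [← lintegral_const_mul' _ _ ENNReal.ofReal_ne_top]
    refine lintegral_mono fun y => ?_
    simp only
    rw [← ENNReal.ofReal_sum_of_nonneg fun g _ => partialLoss_nonneg _ _ _,
      ← ENNReal.ofReal_mul (by positivity)]
    refine ENNReal.ofReal_le_ofReal ?_
    unfold partialLoss loss
    rw [show 2 * (n : ℝ) * (1 / n * ∑ i, (est y i - M x i) ^ 2) =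
      ∑ i, 2 * (est y i - M x i) ^ 2 by rw [Finset.mul_sum, Finset.mul_sum]; congr; ext; field_simp]
    have hswap : ∑ g, ∑ v ∈ U g, (est y v - M x v) ^ 2 =
        ∑ v, ∑ g with v ∈ U g, (est y v - M x v) ^ 2 :=
      Finset.sum_comm' (by simp)
    rw [hswap]
    refine Finset.sum_le_sum fun v _ => ?_
    rw [Finset.sum_const, nsmul_eq_mul]
    gcongr
    exact_mod_cast hU v
  -- With the other coordinates frozen, the Fano bound applies to coordinate `g`; resampling that
  -- coordinate turns it into a bound on the uniform average.
  have hJsum : ∀ g, X.card * ENNReal.ofReal (δ g / 32) ≤ ∑ x ∈ X, J g x := by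
    intro g
    have h1 : ∀ x ∈ X, ENNReal.ofReal ((P g).card * (δ g / 32)) ≤
        ∑ i ∈ P g, J g (Function.update x g i) := fun x hx =>
      sum_lintegral_partialLoss_ge hσ (P g) (hN g) (fun i => M (Function.update x g i))
        (M (Function.update x g (c g))) (hclose x hx g) (U g) (hδ g) (hsep x hx g) hest
    have h2 := Finset.sum_le_sum h1
    rw [sum_piFinset_sum_update, Finset.sum_const, nsmul_eq_mul, nsmul_eq_mul,
      ENNReal.ofReal_mul (by positivity), ENNReal.ofReal_natCast, mul_left_comm] at h2
    refine (ENNReal.mul_le_mul_iff_right ?_ (ENNReal.natCast_ne_top _)).1 h2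
    have := hN g
    exact_mod_cast (by omega : (P g).card ≠ 0)
  have hfin : X.card * ENNReal.ofReal ((∑ g, δ g) / 32) ≤ X.card * (ENNReal.ofReal (2 * n) * R) := by
    calc X.card * ENNReal.ofReal ((∑ g, δ g) / 32)
        = ∑ g, X.card * ENNReal.ofReal (δ g / 32) := by
          rw [Finset.sum_div, ENNReal.ofReal_sum_of_nonneg fun g _ => by have := hδ g; positivity,
            Finset.mul_sum]
      _ ≤ ∑ g, ∑ x ∈ X, J g x := Finset.sum_le_sum fun g _ => hJsum g
      _ = ∑ x ∈ X, ∑ g, J g x := Finset.sum_comm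
      _ ≤ ∑ x ∈ X, ENNReal.ofReal (2 * n) * R := by
          refine Finset.sum_le_sum fun x hx => (hrisk x).trans ?_
          gcongr
          exact le_iSup₂_of_le (M x) (hM x hx) le_rfl
      _ = _ := by rw [Finset.sum_const, nsmul_eq_mul]
  have h3 := (ENNReal.mul_le_mul_iff_right (by exact_mod_cast hXpos)
    (ENNReal.natCast_ne_top _)).1 hfin
  have h4 : ENNReal.ofReal ((∑ g, δ g) / 32) =
      ENNReal.ofReal (2 * n) * ENNReal.ofReal ((∑ g, δ g) / 64 / n) := by
    rw [← ENNReal.ofReal_mul (by positivity)]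
    congr 1
    field_simp
    ring
  rw [h4] at h3
  refine (ENNReal.mul_le_mul_iff_right ?_ ENNReal.ofReal_ne_top).1 h3
  exact (ENNReal.ofReal_pos.2 (by positivity)).ne'

end Testing

/-! ### Depth first order: subtrees as intervals, blocks and cuts -/

section Tree

/-- `L` assigns to each node a word such that the word of a child extends the word of its parent
by one letter, for instance the list of the nodes on the path from the root. -/
structure IsRootPaths {n : ℕ} (G : SimpleGraph (Fin n)) (r : Fin n)
    (L : Fin n → List (Fin n)) : Prop where
  injective : Function.Injective L
  child : ∀ i, ∀ j ∈ children G r i, L j = L i ++ [j]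

/-- The word is the support of a geodesic from the root. It ends at its node, hence injectivity;
uniqueness of paths in a tree makes the geodesic of a child extend that of its parent. -/
lemma exists_isRootPaths {n : ℕ} {G : SimpleGraph (Fin n)} (hG : G.IsTree) (r : Fin n) :
    ∃ L, IsRootPaths G r L := by
  choose p hp hd using hG.1.exists_path_of_dist r
  refine ⟨fun x => (p x).support, ?_, ?_⟩
  · intro x y hxy
    have h1 := (p x).getLast_support
    have h2 := (p y).getLast_support
    simp only at hxy
    simp only [hxy] at h1
    exact h1.symm.trans h2
  · intro i j hj
    simp only [children, Finset.mem_filter, Finset.mem_univ, true_and] at hj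
    have hpath : ((p i).concat hj.1).IsPath := by
      apply SimpleGraph.Walk.isPath_of_length_eq_dist
      rw [SimpleGraph.Walk.length_concat, hd, hj.2]
    have := (hG.existsUnique_path r j).unique (hp j) hpath
    simp only [this, SimpleGraph.Walk.support_concat]

/-- The descendants of `v`, including `v` itself. -/
def subtree {n : ℕ} (L : Fin n → List (Fin n)) (v : Fin n) : Finset (Fin n) :=
  Finset.univ.filter fun x => L v <+: L x

lemma mem_subtree {n : ℕ} {L : Fin n → List (Fin n)} {v x : Fin n} :
    x ∈ subtree L v ↔ L v <+: L x := by
  simp [subtree]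

lemma self_mem_subtree {n : ℕ} (L : Fin n → List (Fin n)) (v : Fin n) : v ∈ subtree L v :=
  mem_subtree.2 (List.prefix_refl _)

variable {n : ℕ} {G : SimpleGraph (Fin n)} {r : Fin n} {L : Fin n → List (Fin n)}

/-- The subtrees of siblings are disjoint, because sibling words have equal length and differ, and
none contains the parent. The spare term `w i` is what the cube construction perturbs. -/
lemma IsRootPaths.sum_children_add_le (hL : IsRootPaths G r L) {w : Fin n → ℝ} (hw : ∀ x, 0 ≤ w x)
    (i : Fin n) : ∑ j ∈ children G r i, ∑ x ∈ subtree L j, w x + w i ≤ ∑ x ∈ subtree L i, w x := by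
  have hdisj : Set.PairwiseDisjoint (children G r i : Set (Fin n)) (subtree L) := by
    intro j hj k hk hjk
    refine Finset.disjoint_left.2 fun x hx hx' => hjk ?_
    rw [mem_subtree, hL.child i j hj] at hx
    rw [mem_subtree, hL.child i k hk] at hx'
    have := List.prefix_of_prefix_length_le hx hx' (by simp)
    simpa using this.eq_of_length (by simp)
  have hi : i ∉ (children G r i).biUnion (subtree L) := by
    simp only [Finset.mem_biUnion, not_exists, not_and]
    intro j hj hij
    rw [mem_subtree, hL.child i j hj] at hij
    simpa using hij.length_le
  rw [← Finset.sum_biUnion hdisj, add_comm, ← Finset.sum_insert hi]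
  refine Finset.sum_le_sum_of_subset_of_nonneg ?_ fun x _ _ => hw x
  refine Finset.insert_subset (self_mem_subtree L i) ?_
  refine Finset.biUnion_subset.2 fun j hj x hx => ?_
  rw [mem_subtree, hL.child i j hj] at hx
  exact mem_subtree.2 ((List.prefix_append _ _).trans hx)

/-- Nonnegative weights on the nodes, accumulated towards the root, form a flow. -/
lemma IsRootPaths.sum_subtree_mem_boundedFlows (hL : IsRootPaths G r L) {w : Fin n → ℝ}
    (hw : ∀ x, 0 ≤ w x) {V : ℝ} (hV : ∑ x, w x ≤ V) :
    (fun v => ∑ x ∈ subtree L v, w x) ∈ boundedFlows G r V := by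
  refine ⟨fun i => ?_, ?_⟩
  · have := hL.sum_children_add_le hw i
    have := hw i
    linarith
  · exact (Finset.sum_le_sum_of_subset_of_nonneg (Finset.subset_univ _) fun x _ _ => hw x).trans hV

lemma cons_le_cons_iff_lt_or {α : Type*} [LinearOrder α] {a b : α} {l k : List α} :
    a :: l ≤ b :: k ↔ a < b ∨ a = b ∧ l ≤ k := by
  rw [← not_lt, List.cons_lt_cons_iff, ← not_lt (a := k)]
  rcases lt_trichotomy a b with h | h | h
  · simp [h, h.not_gt, h.ne']
  · simp [h]
  · simp [h, h.not_gt, h.ne']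

lemma prefix_le {α : Type*} [LinearOrder α] :
    ∀ {l m : List α}, l <+: m → l ≤ m
  | [], _, _ => not_lt.1 (List.not_lt_nil _)
  | a :: l, m, h => by
    obtain ⟨m', rfl, hm'⟩ := List.cons_prefix_iff.1 h
    exact List.cons_le_cons a (prefix_le hm')

/-- Words with a common prefix are consecutive in lexicographic order; this is why subtrees are
intervals of ranks. -/
lemma prefix_of_prefix_of_le {α : Type*} [LinearOrder α] :
    ∀ {l m k : List α}, l <+: m → l ≤ k → k ≤ m → l <+: k
  | [], _, _, _, _, _ => List.nil_prefix
  | a :: l, m, k, hlm, hlk, hkm => by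
    obtain ⟨m', rfl, hm'⟩ := List.cons_prefix_iff.1 hlm
    cases k with
    | nil => exact absurd hlk (not_le.2 (List.nil_lt_cons _ _))
    | cons b k =>
      rw [cons_le_cons_iff_lt_or] at hlk hkm
      have hab : a = b := by
        rcases hlk with h | h
        · rcases hkm with h' | h'
          · exact absurd h (lt_asymm h')
          · exact h'.1.symm
        · exact h.1
      subst hab
      simp only [lt_self_iff_false, true_and, false_or] at hlk hkm
      exact List.cons_prefix_cons.2 ⟨rfl, prefix_of_prefix_of_le hm' hlk hkm⟩

/-- The position of a node in the lexicographic (depth first) order. -/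
def rank (L : Fin n → List (Fin n)) (x : Fin n) : ℕ :=
  (Finset.univ.filter fun y => L y < L x).card

lemma rank_lt_rank {x y : Fin n} (h : L x < L y) : rank L x < rank L y := by
  refine Finset.card_lt_card ⟨fun z hz => ?_, fun hs => ?_⟩
  · simp only [Finset.mem_filter, Finset.mem_univ, true_and] at hz ⊢
    exact hz.trans h
  · have := hs (Finset.mem_filter.2 ⟨Finset.mem_univ x, h⟩)
    simp at this

lemma rank_le_rank {x y : Fin n} (h : L x ≤ L y) : rank L x ≤ rank L y := by
  rcases h.lt_or_eq with h | h
  · exact (rank_lt_rank h).le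
  · simp [rank, h]

lemma le_of_rank_le_rank {x y : Fin n} (h : rank L x ≤ rank L y) : L x ≤ L y :=
  not_lt.1 fun h' => (rank_lt_rank h').not_ge h

lemma IsRootPaths.rank_injective (hL : IsRootPaths G r L) : Function.Injective (rank L) :=
  fun _ _ h => hL.injective (le_antisymm (le_of_rank_le_rank h.le) (le_of_rank_le_rank h.ge))

lemma rank_lt (L : Fin n → List (Fin n)) (x : Fin n) : rank L x < n := by
  have : (Finset.univ.filter fun y => L y < L x) ⊂ Finset.univ := by
    refine Finset.filter_ssubset.2 ⟨x, Finset.mem_univ x, lt_irrefl _⟩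
  simpa [rank] using Finset.card_lt_card this

lemma rank_le_of_mem_subtree {v x : Fin n} (h : x ∈ subtree L v) : rank L v ≤ rank L x :=
  rank_le_rank (prefix_le (mem_subtree.1 h))

lemma mem_subtree_of_rank_le {v x y : Fin n} (hx : x ∈ subtree L v) (h1 : rank L v ≤ rank L y)
    (h2 : rank L y ≤ rank L x) : y ∈ subtree L v :=
  mem_subtree.2 (prefix_of_prefix_of_le (mem_subtree.1 hx) (le_of_rank_le_rank h1)
    (le_of_rank_le_rank h2))

/-- The `g`-th block of `m` consecutive nodes in the depth first order. -/
def block (L : Fin n → List (Fin n)) (m g : ℕ) : Finset (Fin n) :=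
  Finset.univ.filter fun x => rank L x / m = g

lemma mem_block {m g : ℕ} {x : Fin n} : x ∈ block L m g ↔ rank L x / m = g := by
  simp [block]

/-- Ranks are a bijection onto `0, ..., n - 1`; the bound on `g` discards the incomplete last block.
-/
lemma IsRootPaths.card_block (hL : IsRootPaths G r L) {m g : ℕ} (hm : 0 < m) (hg : g < n / m) :
    (block L m g).card = m := by
  have himg : Finset.univ.image (rank L) = Finset.range n := by
    refine Finset.eq_of_subset_of_card_le ?_ ?_
    · intro k hk
      obtain ⟨x, -, rfl⟩ := Finset.mem_image.1 hk
      exact Finset.mem_range.2 (rank_lt L x)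
    · rw [Finset.card_image_of_injective _ hL.rank_injective]
      simp
  have h : (block L m g).image (rank L) = Finset.Ico (g * m) (g * m + m) := by
    ext k
    rw [Finset.mem_image, Finset.mem_Ico]
    have hdiv : k / m = g ↔ g * m ≤ k ∧ k < g * m + m := by
      rw [Nat.div_eq_iff hm]
      omega
    constructor
    · rintro ⟨x, hx, rfl⟩
      exact hdiv.1 (mem_block.1 hx)
    · intro hk
      have hkn : k ∈ Finset.univ.image (rank L) := by
        rw [himg, Finset.mem_range]
        have : (g + 1) * m ≤ n := (Nat.le_div_iff_mul_le hm).1 hg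
        nlinarith
      obtain ⟨x, -, rfl⟩ := Finset.mem_image.1 hkn
      exact ⟨x, mem_block.2 (hdiv.2 hk), rfl⟩
  rw [← Finset.card_image_of_injective _ hL.rank_injective, h]
  simp

/-- The nodes whose subtree splits the block. -/
def cut (L : Fin n → List (Fin n)) (m g : ℕ) : Finset (Fin n) :=
  Finset.univ.filter fun v => ∃ x ∈ block L m g, ∃ y ∈ block L m g,
    x ∈ subtree L v ∧ y ∉ subtree L v

/-- A subtree is an interval in the depth first order, so it splits at most two blocks. -/
lemma card_filter_mem_cut_le (L : Fin n → List (Fin n)) (m : ℕ) (s : Finset ℕ) (v : Fin n) :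
    (s.filter fun g => v ∈ cut L m g).card ≤ 2 := by
  -- `e` is the last node of the subtree, whose ranks run from that of `v` to that of `e`. A split
  -- block must contain one of these two end nodes.
  obtain ⟨e, he, hmax⟩ := Finset.exists_max_image (subtree L v) (rank L) ⟨v, self_mem_subtree L v⟩
  refine (Finset.card_le_card (t := {rank L v / m, rank L e / m}) ?_).trans Finset.card_le_two
  intro g hg
  simp only [cut, Finset.mem_filter, Finset.mem_univ, true_and, mem_block] at hg
  obtain ⟨-, x, hx, y, hy, hxv, hyv⟩ := hg
  simp only [Finset.mem_insert, Finset.mem_singleton]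
  by_cases h : rank L v ≤ rank L y
  · right
    have h1 : rank L e ≤ rank L y := by
      by_contra h2
      exact hyv (mem_subtree_of_rank_le he h (by omega))
    refine le_antisymm ?_ ?_
    · exact hx ▸ Nat.div_le_div_right (hmax x hxv)
    · exact hy ▸ Nat.div_le_div_right h1
  · left
    refine le_antisymm ?_ ?_
    · exact hy ▸ Nat.div_le_div_right (by omega)
    · exact hx ▸ Nat.div_le_div_right (rank_le_of_mem_subtree hxv)

/-- Double counting of pairs of a node and a block that its subtree splits. -/
lemma sum_card_cut_le (L : Fin n → List (Fin n)) (m : ℕ) (s : Finset ℕ) :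
    ∑ g ∈ s, (cut L m g).card ≤ 2 * n := by
  have h : ∑ g ∈ s, ∑ v ∈ cut L m g, 1 = ∑ v : Fin n, ∑ g ∈ s with v ∈ cut L m g, 1 :=
    Finset.sum_comm' (by simp)
  simp only [Finset.sum_const, smul_eq_mul, mul_one] at h
  rw [h]
  refine (Finset.sum_le_card_nsmul _ _ 2 fun v _ => card_filter_mem_cut_le L m s v).trans ?_
  simp [mul_comm]

/-- The nodes that have exactly one of `x` and `y` below them. -/
def separators (L : Fin n → List (Fin n)) (x y : Fin n) : Finset (Fin n) :=
  Finset.univ.filter fun v => ¬(x ∈ subtree L v ↔ y ∈ subtree L v)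

lemma separators_comm (L : Fin n → List (Fin n)) (x y : Fin n) :
    separators L x y = separators L y x := by
  simp only [separators, iff_comm]

lemma separators_subset_cut {m g : ℕ} {x y : Fin n} (hx : x ∈ block L m g)
    (hy : y ∈ block L m g) : separators L x y ⊆ cut L m g := by
  intro v hv
  simp only [separators, cut, Finset.mem_filter, Finset.mem_univ, true_and] at hv ⊢
  by_cases h : x ∈ subtree L v
  · exact ⟨x, hx, y, hy, h, fun h' => hv ⟨fun _ => h', fun _ => h⟩⟩
  · exact ⟨y, hy, x, hx, by_contra fun h' => hv ⟨fun h'' => (h h'').elim, fun h'' => (h' h'').elim⟩,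
      h⟩

/-- Testing with the subtrees of `x` and of `y` themselves shows that each word is a prefix of the
other. -/
lemma IsRootPaths.eq_of_separators (hL : IsRootPaths G r L) {x y : Fin n}
    (h : (separators L x y).card = 0) : x = y := by
  rw [Finset.card_eq_zero, separators, Finset.filter_eq_empty_iff] at h
  simp only [Finset.mem_univ, true_implies, not_not] at h
  have h1 := mem_subtree.1 (h.1 (self_mem_subtree L x))
  have h2 := mem_subtree.1 (h.2 (self_mem_subtree L y))
  exact hL.injective (h1.eq_of_length (le_antisymm h1.length_le h2.length_le))

end Tree

/-! ### Multiscale packing -/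

section Packing

variable {α : Type*} {h : α → α → ℕ}

/-- A separated subset of maximal cardinality is also a net. -/
lemma exists_maximal_separated (hsymm : ∀ x y, h x y = h y x) (A : Finset α) (D : ℕ) :
    ∃ P ⊆ A, (∀ x ∈ P, ∀ y ∈ P, x ≠ y → D < 2 * h x y) ∧
      ∀ x ∈ A, x ∈ P ∨ ∃ p ∈ P, 2 * h x p ≤ D := by
  classical
  obtain ⟨P, hP, hmax⟩ := Finset.exists_max_image
    (A.powerset.filter fun P => ∀ x ∈ P, ∀ y ∈ P, x ≠ y → D < 2 * h x y) Finset.card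
    ⟨∅, by simp⟩
  simp only [Finset.mem_filter, Finset.mem_powerset] at hP hmax
  refine ⟨P, hP.1, hP.2, fun x hx => ?_⟩
  by_contra! hcon
  have := hmax (insert x P) ⟨Finset.insert_subset hx hP.1, ?_⟩
  · rw [Finset.card_insert_of_notMem hcon.1] at this
    omega
  · intro y hy z hz hyz
    rw [Finset.mem_insert] at hy hz
    rcases hy with rfl | hy <;> rcases hz with rfl | hz
    · exact absurd rfl hyz
    · exact hcon.2 z hz
    · rw [hsymm]
      exact hcon.2 y hy
    · exact hP.2 y hy z hz hyz

/-- A finite set of large cardinality contains, at some dyadic scale, a separated set of large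
cardinality which lies in a ball of comparable radius. -/
lemma exists_separated_in_ball (hsymm : ∀ x y, h x y = h y x) (hself : ∀ x, h x x = 0)
    (hzero : ∀ x y, h x y = 0 → x = y) {t : ℝ} (ht : 0 < t) :
    ∀ (J : ℕ) (A : Finset α) (c : α), (∀ x ∈ A, h x c ≤ 2 ^ J) →
      t * (1 - (1 / 2) ^ (J + 1)) < Real.log A.card →
      ∃ i ≤ J, ∃ P ⊆ A, ∃ c', (∀ x ∈ P, h x c' ≤ 2 ^ i) ∧
        (∀ x ∈ P, ∀ y ∈ P, x ≠ y → 2 ^ i < 2 * h x y) ∧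
        t * (1 / 2) ^ (i + 1) ≤ Real.log P.card := by
  classical
  intro J
  induction J with
  -- At scale 1 distinct points are already separated, so `A` itself serves.
  | zero =>
    intro A c hc hA
    refine ⟨0, le_rfl, A, subset_rfl, c, hc, fun x _ y _ hxy => ?_, by linarith⟩
    have : h x y ≠ 0 := fun h0 => hxy (hzero x y h0)
    omega
  | succ J ih =>
    intro A c hc hA
    -- Either the packing at the top scale is rich enough, or it gives few balls of half the radius,
    -- one of which keeps most of the entropy. The entropy budget is the geometric series of the
    -- thresholds `t * (1 / 2) ^ (i + 1)`, so what remains suffices for the smaller scales.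
    obtain ⟨P, hPA, hsep, hcov⟩ := exists_maximal_separated hsymm A (2 ^ (J + 1))
    by_cases hP : t * (1 / 2) ^ (J + 1 + 1) ≤ Real.log P.card
    · exact ⟨J + 1, le_rfl, P, hPA, c, fun x hx => hc x (hPA hx), hsep, hP⟩
    have hApos : 0 < A.card := by
      by_contra h0
      rw [show A.card = 0 by omega] at hA
      -- An empty `A` is excluded since `Real.log 0 = 0` while the budget is nonnegative.
      have h1 : ((1 : ℝ) / 2) ^ (J + 1 + 1) ≤ 1 := pow_le_one₀ (by norm_num) (by norm_num)
      simp only [Nat.cast_zero, Real.log_zero] at hA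
      nlinarith
    have hPne : P.Nonempty := by
      obtain ⟨x, hx⟩ := Finset.card_pos.1 hApos
      rcases hcov x hx with h1 | ⟨p, hp, -⟩
      exacts [⟨x, h1⟩, ⟨p, hp⟩]
    set B : α → Finset α := fun p => A.filter fun x => h x p ≤ 2 ^ J with hB
    have hsub : A ⊆ P.biUnion B := by
      intro x hx
      rw [Finset.mem_biUnion]
      rcases hcov x hx with h1 | ⟨p, hp, hxp⟩
      · exact ⟨x, h1, Finset.mem_filter.2 ⟨hx, by rw [hself]; positivity⟩⟩
      · exact ⟨p, hp, Finset.mem_filter.2 ⟨hx, by rw [pow_succ] at hxp; omega⟩⟩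
    have hcard : (A.card : ℝ) ≤ ∑ p ∈ P, ((B p).card : ℝ) := by
      exact_mod_cast (Finset.card_le_card hsub).trans Finset.card_biUnion_le
    have hPpos : (0 : ℝ) < P.card := by exact_mod_cast hPne.card_pos
    obtain ⟨p, -, hp⟩ := Finset.exists_le_of_sum_le (s := P) (f := fun _ => (A.card : ℝ) / P.card)
      (g := fun p => ((B p).card : ℝ)) hPne (by
        rw [Finset.sum_const, nsmul_eq_mul, mul_div_cancel₀ _ hPpos.ne']
        exact hcard)
    have hA' : (0 : ℝ) < A.card := by exact_mod_cast hApos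
    have hlog := Real.log_le_log (by positivity) hp
    rw [Real.log_div hA'.ne' hPpos.ne'] at hlog
    push Not at hP
    obtain ⟨i, hi, P', hP', rest⟩ := ih (B p) p (fun x hx => (Finset.mem_filter.1 hx).2) (by
      rw [pow_succ _ (J + 1)] at hA hP
      linarith)
    exact ⟨i, by omega, P', hP'.trans (Finset.filter_subset _ _), rest⟩

end Packing

/-! ### A rich separated set in each block -/

section Gadget

variable {n : ℕ} {G : SimpleGraph (Fin n)} {r : Fin n} {L : Fin n → List (Fin n)}

/-- Inside a block there is a set of nodes which is rich at some scale `D`. -/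
lemma IsRootPaths.exists_separated_in_block (hL : IsRootPaths G r L) {m g : ℕ} (hm : 2 ≤ m)
    (hg : g < n / m) :
    ∃ (D : ℕ) (P : Finset (Fin n)) (c : Fin n), 0 < D ∧ D ≤ 2 * (cut L m g).card ∧
      P ⊆ block L m g ∧ (∀ x ∈ P, (separators L x c).card ≤ D) ∧
      (∀ x ∈ P, ∀ y ∈ P, x ≠ y → D ≤ 2 * (separators L x y).card) ∧
      Real.log m ≤ 2 * D * Real.log P.card ∧ P.card ≤ m := by
  have hcard := hL.card_block (by omega : 0 < m) hg
  obtain ⟨c, hc, c', hc', hne⟩ := Finset.one_lt_card.1 (by omega : 1 < (block L m g).card)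
  have hcut : (cut L m g).card ≠ 0 := by
    intro h0
    refine hne (hL.eq_of_separators (Nat.le_zero.1 ?_))
    exact h0 ▸ Finset.card_le_card (separators_subset_cut hc hc')
  have hlog : 0 < Real.log m := Real.log_pos (by exact_mod_cast (by omega : 1 < m))
  obtain ⟨i, hi, P, hP, c₁, h1, h2, h3⟩ := exists_separated_in_ball
    (h := fun x y => (separators L x y).card) (fun x y => by rw [separators_comm])
    (fun x => by simp [separators]) (fun x y => hL.eq_of_separators) hlog
    -- The top scale is the first power of 2 above the cut size, which bounds all distances in the
    -- block and is at most twice the cut size.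
    (Nat.log 2 (cut L m g).card + 1) (block L m g) c
    (fun x hx => (Finset.card_le_card (separators_subset_cut hx hc)).trans
      (Nat.lt_pow_succ_log_self (by norm_num) _).le)
    (by
      rw [hcard]
      have : (0 : ℝ) < (1 / 2) ^ (Nat.log 2 (cut L m g).card + 1 + 1) := by positivity
      nlinarith)
  refine ⟨2 ^ i, P, c₁, by positivity, ?_, hP, h1, fun x hx y hy hxy => (h2 x hx y hy hxy).le, ?_,
    hcard ▸ Finset.card_le_card hP⟩
  · calc 2 ^ i ≤ 2 ^ (Nat.log 2 (cut L m g).card + 1) := Nat.pow_le_pow_right (by norm_num) hi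
      _ ≤ _ := by
        rw [pow_succ, mul_comm]
        exact Nat.mul_le_mul_left 2 (Nat.pow_log_le_self 2 hcut)
  · push_cast
    have h4 : (2 : ℝ) ^ (i + 1) * (1 / 2) ^ (i + 1) = 1 := by rw [← mul_pow]; norm_num
    calc Real.log m = 2 ^ (i + 1) * (Real.log m * (1 / 2) ^ (i + 1)) := by
          linear_combination (- Real.log m) * h4
      _ ≤ 2 ^ (i + 1) * Real.log P.card := by gcongr
      _ = _ := by ring

end Gadget

/-! ### Families of hypotheses: paths in blocks, two points, cube -/

section LowerBounds

variable {n : ℕ} {G : SimpleGraph (Fin n)} {r : Fin n} {L : Fin n → List (Fin n)}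

/-- The flow sending `a g` from the root to the node `x g`, for each `g`. -/
noncomputable def pathFlow {ι : Type*} [Fintype ι] (L : Fin n → List (Fin n)) (a : ι → ℝ)
    (x : ι → Fin n) (v : Fin n) : ℝ :=
  ∑ g, if x g ∈ subtree L v then a g else 0

lemma IsRootPaths.pathFlow_mem_boundedFlows {ι : Type*} [Fintype ι] (hL : IsRootPaths G r L)
    {a : ι → ℝ} (ha : ∀ g, 0 ≤ a g) {V : ℝ} (hV : ∑ g, a g ≤ V) (x : ι → Fin n) :
    pathFlow L a x ∈ boundedFlows G r V := by
  have h := hL.sum_subtree_mem_boundedFlows (w := fun y => ∑ g, if x g = y then a g else 0)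
    (fun y => Finset.sum_nonneg fun g _ => by split_ifs <;> simp [ha]) (V := V) (by
      rw [Finset.sum_comm]
      simpa using hV)
  convert h using 1
  ext v
  rw [Finset.sum_comm]
  simp [pathFlow]

/-- The paths of the other blocks cancel in the difference. -/
lemma pathFlow_update_sub_sq {ι : Type*} [Fintype ι] [DecidableEq ι] (L : Fin n → List (Fin n))
    (a : ι → ℝ) (x : ι → Fin n) (g : ι) (i j v : Fin n) :
    (pathFlow L a (Function.update x g i) v - pathFlow L a (Function.update x g j) v) ^ 2 =
      if v ∈ separators L i j then a g ^ 2 else 0 := by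
  have hrest : ∀ k : Fin n, pathFlow L a (Function.update x g k) v =
      (if k ∈ subtree L v then a g else 0) +
        ∑ h ∈ Finset.univ.erase g, if x h ∈ subtree L v then a h else 0 := by
    intro k
    rw [pathFlow, ← Finset.add_sum_erase _ _ (Finset.mem_univ g)]
    congr 1
    · simp
    · refine Finset.sum_congr rfl fun h hh => ?_
      rw [Function.update_of_ne (Finset.ne_of_mem_erase hh)]
  rw [hrest i, hrest j, add_sub_add_right_eq_sub]
  by_cases hi : i ∈ subtree L v <;> by_cases hj : j ∈ subtree L v <;>
    simp [separators, hi, hj]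

lemma sum_pathFlow_update_sub_sq {ι : Type*} [Fintype ι] [DecidableEq ι]
    (L : Fin n → List (Fin n)) (a : ι → ℝ) (x : ι → Fin n) (g : ι) (i j : Fin n)
    {U : Finset (Fin n)} (hU : separators L i j ⊆ U) :
    ∑ v ∈ U, (pathFlow L a (Function.update x g i) v -
      pathFlow L a (Function.update x g j) v) ^ 2 = (separators L i j).card * a g ^ 2 := by
  simp_rw [pathFlow_update_sub_sq]
  rw [Finset.sum_ite_mem, Finset.inter_eq_right.2 hU, Finset.sum_const, nsmul_eq_mul]

/-- The risk bound obtained from flows through separated sets of nodes in different blocks. -/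
lemma IsRootPaths.minimaxRisk_ge_of_separated (hL : IsRootPaths G r L) {σ : ℝ} (hσ : 0 < σ)
    {V : ℝ} {m : ℕ} (s : Finset ℕ) (D : ℕ → ℕ) (P : ℕ → Finset (Fin n)) (c : ℕ → Fin n)
    (hP : ∀ g ∈ s, P g ⊆ block L m g) (hN : ∀ g ∈ s, 2 ≤ (P g).card)
    (hclose : ∀ g ∈ s, ∀ x ∈ P g, (separators L x (c g)).card ≤ D g)
    (hsep : ∀ g ∈ s, ∀ x ∈ P g, ∀ y ∈ P g, x ≠ y → D g ≤ 2 * (separators L x y).card)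
    (a : ℕ → ℝ) (ha : ∀ g ∈ s, 0 ≤ a g)
    (haD : ∀ g ∈ s, a g ^ 2 * D g ≤ σ ^ 2 * Real.log (P g).card / 2)
    (hV : ∑ g ∈ s, a g ≤ V) :
    ENNReal.ofReal ((∑ g ∈ s, a g ^ 2 * D g / 2) / 64 / n) ≤
      minimaxRisk σ (boundedFlows G r V) := by
  rw [← Finset.sum_coe_sort s]
  refine minimaxRisk_ge_of_product hσ (fun g : s => P g) (fun g => hN g g.2)
    (pathFlow L fun g : s => a g) (fun x _ => hL.pathFlow_mem_boundedFlows (ι := s)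
      (a := fun g => a g) (fun g => ha g g.2) (by rwa [Finset.sum_coe_sort s a]) x)
    (fun g => c g) ?_ (fun g => cut L m g)
    (δ := fun g : s => a g ^ 2 * D g / 2) (fun g => by positivity) ?_ ?_
  · intro x _ g i hi
    rw [sum_pathFlow_update_sub_sq _ _ _ _ _ _ (Finset.subset_univ _)]
    refine le_trans ?_ (haD g g.2)
    rw [mul_comm]
    gcongr
    exact hclose g g.2 i hi
  · intro x _ g i hi j hj hij
    rw [partialLoss, sum_pathFlow_update_sub_sq _ _ _ _ _ _
      (separators_subset_cut (hP g g.2 hi) (hP g g.2 hj))]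
    have : (D g : ℝ) ≤ 2 * (separators L i j).card := by exact_mod_cast hsep g g.2 i hi j hj hij
    nlinarith [sq_nonneg (a g)]
  · intro v
    refine le_trans ?_ (card_filter_mem_cut_le L m s v)
    rw [← Finset.card_map (Function.Embedding.subtype (· ∈ s))]
    refine Finset.card_le_card fun g hg => ?_
    simp only [Finset.mem_map, Finset.mem_filter, Finset.mem_univ, true_and,
      Function.Embedding.subtype_apply, Subtype.exists] at hg
    obtain ⟨g', hg', hv, rfl⟩ := hg
    exact Finset.mem_filter.2 ⟨hg', hv⟩

/-- Greedy choice of a subset whose sum is close to a given bound. -/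
lemma exists_subset_sum_between (s : Finset ℕ) {a : ℕ → ℝ} {V : ℝ} (hV : 0 ≤ V)
    (ha : ∀ g ∈ s, a g ≤ V / 2) :
    ∃ t ⊆ s, ∑ g ∈ t, a g ≤ V ∧ min (V / 2) (∑ g ∈ s, a g) ≤ ∑ g ∈ t, a g := by
  induction s using Finset.induction_on with
  | empty => exact ⟨∅, subset_rfl, by simpa using hV, by simp⟩
  | insert k s hk ih =>
    obtain ⟨t, hts, h1, h2⟩ := ih fun g hg => ha g (Finset.mem_insert_of_mem hg)
    by_cases ht : V / 2 ≤ ∑ g ∈ t, a g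
    · exact ⟨t, hts.trans (Finset.subset_insert _ _), h1, (min_le_left _ _).trans ht⟩
    · push Not at ht
      have hkt : k ∉ t := fun h => hk (hts h)
      refine ⟨insert k t, Finset.insert_subset_insert k hts, ?_, ?_⟩
      · rw [Finset.sum_insert hkt]
        linarith [ha k (Finset.mem_insert_self k s)]
      · rw [Finset.sum_insert hkt, Finset.sum_insert hk]
        refine (min_le_right _ _).trans ?_
        rcases min_le_iff.1 h2 with h | h
        · linarith
        · linarith

/-- The minimax risk in terms of the block size `m`. The noise level `τ ≤ σ` is a free parameter. -/
lemma IsRootPaths.minimaxRisk_ge_of_blocks (hL : IsRootPaths G r L) {σ τ V : ℝ} (hτ : 0 < τ)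
    (hτσ : τ ≤ σ) {m : ℕ} (hm : 2 ≤ m) (hmV : τ * √(Real.log m) ≤ V) :
    ENNReal.ofReal (τ * √(Real.log m) / 8 *
        min (V / 2) (τ * √(Real.log m) / 16 * (((n / m : ℕ) : ℝ) ^ 2 / n)) / 64 / n) ≤
      minimaxRisk σ (boundedFlows G r V) := by
  have hlog : 0 < Real.log m := Real.log_pos (by exact_mod_cast (by omega : 1 < m))
  have hn : (0 : ℝ) < n := by exact_mod_cast r.pos
  have : Nonempty (Fin n) := ⟨r⟩
  choose! D P c hD0 hDcut hP hclose hsep hlogm hPm using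
    fun g (hg : g < n / m) => hL.exists_separated_in_block hm hg
  set q := τ * √(Real.log m) with hq
  have hq0 : 0 < q := mul_pos hτ (Real.sqrt_pos.2 hlog)
  have hDpos : ∀ g < n / m, (0 : ℝ) < D g := fun g hg => by exact_mod_cast hD0 g hg
  have hlogN : ∀ g < n / m, 0 < Real.log (P g).card := by
    intro g hg
    by_contra! h
    nlinarith [hlogm g hg, hDpos g hg]
  have hN : ∀ g < n / m, 2 ≤ (P g).card := by
    intro g hg
    by_contra! h
    have h' := hlogN g hg
    interval_cases h2 : (P g).card <;> simp at h'
  -- This is below the largest amplitude that Fano allows; the extra factor `1 / 2` yields `a g ≤ V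
  -- / 2`, as the greedy selection requires.
  set a : ℕ → ℝ := fun g => τ / 2 * √(Real.log (P g).card / (2 * D g)) with ha
  have ha0 : ∀ g, 0 ≤ a g := fun g => by positivity
  have hasq : ∀ g < n / m, a g ^ 2 * D g = τ ^ 2 * Real.log (P g).card / 8 := by
    intro g hg
    have := hDpos g hg
    rw [ha]
    simp only
    rw [mul_pow, Real.sq_sqrt (div_nonneg (hlogN g hg).le (by positivity))]
    field_simp
    ring
  have haV : ∀ g < n / m, a g ≤ V / 2 := by
    intro g hg
    have h1 : Real.log (P g).card / (2 * D g) ≤ Real.log m := by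
      have hD1 : (1 : ℝ) ≤ D g := by exact_mod_cast hD0 g hg
      rw [div_le_iff₀ (by positivity)]
      have : Real.log (P g).card ≤ Real.log m := Real.log_le_log
        (by have := hN g hg; positivity) (by exact_mod_cast hPm g hg)
      nlinarith
    calc a g ≤ τ / 2 * √(Real.log m) := by simp only [ha]; gcongr
      _ ≤ V / 2 := by rw [hq] at hmV; linarith
  have halow : ∀ g < n / m, q / (4 * D g) ≤ a g := by
    intro g hg
    have hDg := hDpos g hg
    have h1 : √(Real.log m) / (2 * D g) ≤ √(Real.log (P g).card / (2 * D g)) := by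
      refine Real.le_sqrt_of_sq_le ?_
      rw [div_pow, Real.sq_sqrt hlog.le, div_le_div_iff₀ (by positivity) (by positivity)]
      nlinarith [hlogm g hg]
    calc q / (4 * D g) = τ / 2 * (√(Real.log m) / (2 * D g)) := by
          rw [hq]; field_simp; norm_num
      _ ≤ a g := by simp only [ha]; gcongr
  -- The error is at least linear in the flow spent, at a rate that does not depend on the scale `D
  -- g`.
  have hloss : ∀ g < n / m, q / 8 * a g ≤ a g ^ 2 * D g / 2 := by
    intro g hg
    have hDg := hDpos g hg
    have h1 := halow g hg
    rw [div_le_iff₀ (by positivity)] at h1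
    nlinarith [ha0 g]
  have htotal : q / 16 * (((n / m : ℕ) : ℝ) ^ 2 / n) ≤ ∑ g ∈ Finset.range (n / m), a g := by
    rcases Nat.eq_zero_or_pos (n / m) with h0 | h0
    · simp [h0]
    have hG : (0 : ℝ) < (n / m : ℕ) := by exact_mod_cast h0
    set K : ℝ := 2 * n / (n / m : ℕ) with hK
    have hKpos : 0 < K := by positivity
    have hone : ∀ g ∈ Finset.range (n / m),
        q / 8 * (2 / K - (cut L m g).card / K ^ 2) ≤ a g := by
      intro g hg
      rw [Finset.mem_range] at hg
      have hDg := hDpos g hg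
      have hcut : (D g : ℝ) ≤ 2 * (cut L m g).card := by exact_mod_cast hDcut g hg
      have hc : (0 : ℝ) < (cut L m g).card := by linarith
      -- The tangent line of `1 / x` at `K`, an upper bound for the mean cut size, bounds it from
      -- below; summing over blocks amounts to the harmonic mean inequality.
      have h1 : 2 / K - (cut L m g).card / K ^ 2 ≤ 1 / (cut L m g).card := by
        rw [le_div_iff₀ hc]
        have : ((cut L m g).card / K - 1) ^ 2 = (cut L m g).card ^ 2 / K ^ 2 -
          2 / K * (cut L m g).card + 1 := by field_simp; ring
        have h2 := sq_nonneg ((cut L m g).card / K - 1)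
        rw [this] at h2
        have h3 : (2 / K - (cut L m g).card / K ^ 2) * (cut L m g).card =
          2 / K * (cut L m g).card - (cut L m g).card ^ 2 / K ^ 2 := by ring
        linarith
      calc _ ≤ q / 8 * (1 / (cut L m g).card) := by gcongr
        _ = q / (4 * (2 * (cut L m g).card)) := by field_simp; norm_num
        _ ≤ q / (4 * D g) := by gcongr
        _ ≤ a g := halow g hg
    refine le_trans ?_ (Finset.sum_le_sum hone)
    rw [← Finset.mul_sum, Finset.sum_sub_distrib, Finset.sum_const, Finset.card_range,
      nsmul_eq_mul, ← Finset.sum_div]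
    have hsum : (∑ g ∈ Finset.range (n / m), ((cut L m g).card : ℝ)) ≤ 2 * n := by
      exact_mod_cast sum_card_cut_le L m (Finset.range (n / m))
    calc q / 16 * (((n / m : ℕ) : ℝ) ^ 2 / n)
        = q / 8 * ((n / m : ℕ) * (2 / K) - 2 * n / K ^ 2) := by
          rw [hK]; field_simp; ring
      _ ≤ _ := by gcongr
  have hV0 : 0 ≤ V := hq0.le.trans hmV
  obtain ⟨t, ht, h1, h2⟩ := exists_subset_sum_between (Finset.range (n / m)) hV0
    (a := a) fun g hg => haV g (Finset.mem_range.1 hg)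
  have htm : ∀ g ∈ t, g < n / m := fun g hg => Finset.mem_range.1 (ht hg)
  refine le_trans (ENNReal.ofReal_le_ofReal ?_)
    (hL.minimaxRisk_ge_of_separated (hτ.trans_le hτσ) t D P c (fun g hg => hP g (htm g hg))
      (fun g hg => hN g (htm g hg)) (fun g hg => hclose g (htm g hg))
      (fun g hg => hsep g (htm g hg)) a (fun g _ => ha0 g) (fun g hg => ?_) h1)
  · gcongr
    calc _ ≤ q / 8 * ∑ g ∈ t, a g := by
          gcongr
          exact le_trans (by gcongr) h2
      _ ≤ _ := by
          rw [Finset.mul_sum]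
          exact Finset.sum_le_sum fun g hg => hloss g (htm g hg)
  · rw [hasq g (htm g hg)]
    have h3 : τ ^ 2 ≤ σ ^ 2 := by gcongr
    nlinarith [hlogN g (htm g hg), sq_nonneg τ]

/-- Two hypotheses at the root. -/
lemma minimaxRisk_ge_of_root (G : SimpleGraph (Fin n)) (r : Fin n) {σ V b : ℝ} (hσ : 0 < σ)
    (hb : 0 ≤ b) (hbσ : b ≤ σ / 2) (hbV : b ≤ V) :
    ENNReal.ofReal (b ^ 2 / 64 / n) ≤ minimaxRisk σ (boundedFlows G r V) := by
  have hmem : ∀ x : Unit → Bool, Pi.single r (if x () then b else 0) ∈ boundedFlows G r V := by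
    intro x
    -- The root is nobody's child, so flow may be present at the root alone.
    have h0 : ∀ i, ∀ j ∈ children G r i,
        (Pi.single r (if x () then b else 0) : Fin n → ℝ) j = 0 := by
      intro i j hj
      refine Pi.single_eq_of_ne ?_ _
      rintro rfl
      simp [children] at hj
    refine ⟨fun i => ?_, ?_⟩
    · rw [Finset.sum_eq_zero (h0 i)]
      have h1 : (0 : ℝ) ≤ if x () then b else 0 := by split_ifs <;> simp [hb]
      exact (Pi.single_nonneg (α := fun _ : Fin n => ℝ) (i := r)).2 h1 i
    · rw [Pi.single_eq_same]
      split_ifs <;> linarith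
  have := minimaxRisk_ge_of_product hσ (Θ := boundedFlows G r V) (fun _ : Unit => Finset.univ)
    (fun _ => by simp) (fun x => Pi.single r (if x () then b else 0)) (fun x _ => hmem x)
    (fun _ => false) ?_ (fun _ => {r}) (δ := fun _ => b ^ 2) (fun _ => sq_nonneg b) ?_ ?_
  · simpa using this
  · intro x _ g i _
    rw [Finset.sum_eq_single r (fun v _ hv => by simp [hv]) (by simp)]
    have := Real.log_two_gt_d9
    cases i <;> simp <;> nlinarith
  · intro x _ g i _ j _ hij
    cases i <;> cases j <;> simp [partialLoss] at hij ⊢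
  · intro v
    exact (Finset.card_le_univ _).trans (by simp)

/-- A cube of hypotheses, available when the root flow is large. -/
lemma IsRootPaths.minimaxRisk_ge_of_cube (hL : IsRootPaths G r L) {σ V : ℝ} (hσ : 0 < σ)
    (hV : n * σ ≤ V) : ENNReal.ofReal (σ ^ 2 / 256) ≤ minimaxRisk σ (boundedFlows G r V) := by
  have hn : (0 : ℝ) < n := by exact_mod_cast r.pos
  -- The subtree size exceeds the sum over the children by at least 1. This slack lets every node
  -- carry a free bit, and the root value stays at most `n * σ / 2`.
  set M : (Fin n → Bool) → Fin n → ℝ := fun x v =>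
    σ / 2 * ((subtree L v).card - 1 + if x v then 1 else 0) with hM
  have hbit : ∀ y : Bool, (0 : ℝ) ≤ (if y then 1 else 0) ∧ (if y then (1 : ℝ) else 0) ≤ 1 := by
    intro y
    cases y <;> simp
  have hmem : ∀ x, M x ∈ boundedFlows G r V := by
    intro x
    refine ⟨fun i => ?_, ?_⟩
    · have h1 := hL.sum_children_add_le (w := fun _ => 1) (fun _ => zero_le_one) i
      simp only [Finset.sum_const, nsmul_eq_mul, mul_one] at h1
      rw [hM]
      simp only
      rw [← Finset.mul_sum]
      gcongr
      calc _ ≤ ∑ j ∈ children G r i, ((subtree L j).card : ℝ) :=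
            Finset.sum_le_sum fun j _ => by linarith [(hbit (x j)).2]
        _ ≤ _ := by linarith [(hbit (x i)).1]
    · have h1 : ((subtree L r).card : ℝ) ≤ n := by
        exact_mod_cast (Finset.card_le_univ _).trans (by simp)
      have h2 := (hbit (x r)).2
      rw [hM]
      simp only
      nlinarith
  have hsub : ∀ (x : Fin n → Bool) (g : Fin n) (i j : Bool) (v : Fin n), i ≠ j →
      (M (Function.update x g i) v - M (Function.update x g j) v) ^ 2 =
        if v = g then σ ^ 2 / 4 else 0 := by
    intro x g i j v hij
    rw [hM]
    by_cases hv : v = g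
    · subst hv
      cases i <;> cases j <;> simp at hij ⊢ <;> ring
    · simp [hv]
  have := minimaxRisk_ge_of_product hσ (Θ := boundedFlows G r V) (fun _ : Fin n => Finset.univ)
    (fun _ => by simp) M (fun x _ => hmem x) (fun _ => false) ?_ (fun g => {g})
    (δ := fun _ => σ ^ 2 / 4) (fun _ => by positivity) ?_ ?_
  · convert this using 2
    simp only [Finset.sum_const, Finset.card_univ, Fintype.card_fin, nsmul_eq_mul]
    field_simp
    norm_num
  · intro x _ g i _
    have hlog := Real.log_two_gt_d9
    cases i
    · simp only [sub_self, ne_eq, OfNat.ofNat_ne_zero, not_false_eq_true, zero_pow,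
        Finset.sum_const_zero]
      positivity
    · simp_rw [fun v => hsub x g true false v (by simp)]
      simp
      nlinarith
  · intro x _ g i _ j _ hij
    rw [partialLoss, Finset.sum_singleton, hsub x g i j g hij]
    simp
  · intro v
    refine (Finset.card_le_card (t := {v}) fun g hg => ?_).trans (by simp)
    simpa [eq_comm] using hg

end LowerBounds

/-! ### Choice of the block size -/

/-- A convenient block size: a power of `n`, rounded down. -/
lemma exists_block_size {n : ℕ} {ε : ℝ} (hε : 0 < ε) (hε1 : ε ≤ 1)
    (hn : 4 ≤ (n : ℝ) ^ (ε / 2)) :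
    ∃ m : ℕ, 2 ≤ m ∧ m ≤ n ∧ ε / 4 * Real.log n ≤ Real.log m ∧
      (n : ℝ) ^ (1 - ε) / 4 ≤ ((n / m : ℕ) : ℝ) ^ 2 / n := by
  have hn0 : n ≠ 0 := by
    rintro rfl
    rw [Nat.cast_zero, Real.zero_rpow (by positivity)] at hn
    norm_num at hn
  have hn1 : (1 : ℝ) ≤ n := by exact_mod_cast Nat.one_le_iff_ne_zero.2 hn0
  have hnpos : (0 : ℝ) < n := by linarith
  set y : ℝ := (n : ℝ) ^ (ε / 2) with hy
  set z : ℝ := (n : ℝ) ^ (ε / 4) with hz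
  have hz0 : 0 < z := by positivity
  have hyz : y = z ^ 2 := by
    rw [hy, hz, ← Real.rpow_natCast, ← Real.rpow_mul hnpos.le]
    congr 1
    push_cast
    ring
  have hz2 : 2 ≤ z := by nlinarith
  have hyn : y ≤ n := by
    calc y ≤ (n : ℝ) ^ (1 : ℝ) := Real.rpow_le_rpow_of_exponent_le hn1 (by linarith)
      _ = n := Real.rpow_one _
  have hy0 : 0 ≤ y := by positivity
  have hmy : (⌊y⌋₊ : ℝ) ≤ y := Nat.floor_le hy0
  have hym : y < ⌊y⌋₊ + 1 := Nat.lt_floor_add_one y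
  have hmn : ⌊y⌋₊ ≤ n := by exact_mod_cast hmy.trans hyn
  -- As `y = z ^ 2` with `z ≥ 2`, rounding down costs at most a square root, hence the factor `ε /
  -- 4` in the logarithm.
  have hzm : z ≤ (⌊y⌋₊ : ℝ) := by nlinarith
  have hm2 : 2 ≤ ⌊y⌋₊ := by exact_mod_cast hz2.trans hzm
  refine ⟨⌊y⌋₊, hm2, hmn, ?_, ?_⟩
  · rw [← Real.log_rpow hnpos]
    exact Real.log_le_log hz0 hzm
  · set m := ⌊y⌋₊ with hm
    have hmpos : (0 : ℝ) < m := by exact_mod_cast (by omega : 0 < m)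
    have hdiv : (n : ℝ) ≤ 2 * m * (n / m : ℕ) := by
      have h1 : 1 ≤ n / m := (Nat.one_le_div_iff (by omega)).2 hmn
      have h2 := Nat.lt_div_mul_add (a := n) (b := m) (by omega)
      have h3 : n ≤ 2 * m * (n / m) := by nlinarith
      exact_mod_cast h3
    have hG : (n : ℝ) / (2 * y) ≤ (n / m : ℕ) := by
      rw [div_le_iff₀ (by positivity)]
      calc (n : ℝ) ≤ 2 * m * (n / m : ℕ) := hdiv
        _ ≤ 2 * y * (n / m : ℕ) := by gcongr
        _ = _ := by ring
    have hpow : (n : ℝ) ^ (1 - ε) = n / y ^ 2 := by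
      rw [Real.rpow_sub hnpos, Real.rpow_one, hy, ← Real.rpow_natCast, ← Real.rpow_mul hnpos.le]
      congr 2
      push_cast
      ring
    have hypos : 0 < y := by linarith
    calc (n : ℝ) ^ (1 - ε) / 4 = (n / (2 * y)) ^ 2 / n := by
          rw [hpow]; field_simp; norm_num
      _ ≤ _ := by gcongr

/-- The risk bound at intermediate root flows, for large trees. -/
lemma minimaxRisk_ge_of_large {n : ℕ} {G : SimpleGraph (Fin n)} (hG : G.IsTree) (r : Fin n)
    {ε σ τ V : ℝ} (hε : 0 < ε) (hε1 : ε ≤ 1) (hn : 4 ≤ (n : ℝ) ^ (ε / 2)) (hτ : 0 < τ)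
    (hτσ : τ ≤ σ) (hV : τ * √(Real.log n) ≤ V) (hVn : V ≤ τ * (n : ℝ) ^ (1 - ε)) :
    ENNReal.ofReal (√ε / 131072 * (V * τ * (√(Real.log n) / n))) ≤
      minimaxRisk σ (boundedFlows G r V) := by
  obtain ⟨L, hL⟩ := exists_isRootPaths hG r
  obtain ⟨m, hm2, hmn, hlogm, hG2⟩ := exists_block_size hε hε1 hn
  have hnpos : (0 : ℝ) < n := by exact_mod_cast r.pos
  have hmpos : (0 : ℝ) < m := by exact_mod_cast (by omega : 0 < m)
  have hs : √(Real.log m) ≤ √(Real.log n) :=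
    Real.sqrt_le_sqrt (Real.log_le_log hmpos (by exact_mod_cast hmn))
  refine le_trans (ENNReal.ofReal_le_ofReal ?_)
    (hL.minimaxRisk_ge_of_blocks hτ hτσ hm2 (hV.trans' (by gcongr)))
  set s := √(Real.log m) with hs_def
  have hs2 : 1 / 2 ≤ s := by
    refine Real.le_sqrt_of_sq_le ?_
    have h1 := Real.log_two_gt_d9
    have h2 : Real.log 2 ≤ Real.log m := Real.log_le_log (by norm_num) (by exact_mod_cast hm2)
    norm_num
    linarith
  have hlow : √ε / 2 * √(Real.log n) ≤ s := by
    have h4 : √ε / 2 = √(ε / 4) := by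
      rw [Real.sqrt_div hε.le, show (4 : ℝ) = 2 ^ 2 by norm_num, Real.sqrt_sq (by norm_num)]
    rw [h4, ← Real.sqrt_mul (by positivity)]
    exact Real.sqrt_le_sqrt hlogm
  have hV0 : 0 ≤ V := hV.trans' (by positivity)
  -- The capacity of the blocks is not binding, by the upper bound on `V` together with `1 / 2 ≤ s`.
  have hmin : V / 128 ≤ min (V / 2) (τ * s / 16 * (((n / m : ℕ) : ℝ) ^ 2 / n)) := by
    refine le_min (by linarith) ?_
    calc V / 128 ≤ τ * (n : ℝ) ^ (1 - ε) / 128 := by gcongr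
      _ = τ * (1 / 2) / 16 * ((n : ℝ) ^ (1 - ε) / 4) := by ring
      _ ≤ _ := by gcongr
  calc √ε / 131072 * (V * τ * (√(Real.log n) / n))
      = τ * (√ε / 2 * √(Real.log n)) / 8 * (V / 128) / 64 / n := by ring
    _ ≤ _ := by gcongr

end TreeFlow

/-! ### The three regimes -/

theorem mainTheorem2 :
    ∃ c : ℝ, 0 < c ∧ ∀ ε : ℝ, 0 < ε → ∃ cε : ℝ, 0 < cε ∧
      ∀ (C n : ℕ) (G : SimpleGraph (Fin n)) (r : Fin n),
        G.IsTree → TreeFlow.height G r ≤ C →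
        ∀ σ V : ℝ, 0 < σ →
          (0 < V → V ≤ σ * √(Real.log n) →
            ENNReal.ofReal (c * (V ^ 2 / n)) ≤
              TreeFlow.minimaxRisk σ (TreeFlow.boundedFlows G r V)) ∧
          (σ * √(Real.log n) < V → V ≤ σ * (n : ℝ) ^ (1 - ε) →
            ENNReal.ofReal (cε * (V * σ * (√(Real.log n) / n))) ≤
              TreeFlow.minimaxRisk σ (TreeFlow.boundedFlows G r V)) ∧
          (n * σ < V →
            ENNReal.ofReal (c * σ ^ 2) ≤
              TreeFlow.minimaxRisk σ (TreeFlow.boundedFlows G r V)) := by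
  refine ⟨1 / 200000, by norm_num, fun ε hε => ?_⟩
  set ε' := min ε 1 with hε'_def
  have hε' : 0 < ε' := lt_min hε one_pos
  have hε'1 : ε' ≤ 1 := min_le_right _ _
  -- Beyond `K` the block argument applies; below it all quantities are bounded in terms of `ε`,
  -- which `cε` absorbs.
  set K : ℝ := 4 ^ (2 / ε') with hK
  have hKpos : 0 < K := by positivity
  refine ⟨min (√ε' / 131072) (1 / (256 * K ^ 2)), by positivity, ?_⟩
  intro C n G r hG _ σ V hσ
  have hn1 : (1 : ℝ) ≤ n := by exact_mod_cast r.pos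
  have hnpos : (0 : ℝ) < n := by linarith
  have hlog0 : 0 ≤ Real.log n := Real.log_nonneg hn1
  have hlogn : Real.log n ≤ n := (Real.log_le_sub_one_of_pos hnpos).trans (by linarith)
  refine ⟨fun hV hVσ => ?_, fun hV hVσ => ?_, fun hV => ?_⟩
  · have hsqrt : 0 < √(Real.log n) := pos_of_mul_pos_right (hV.trans_le hVσ) hσ.le
    by_cases hn : (4 : ℝ) ≤ (n : ℝ) ^ ((1 / 2 : ℝ) / 2)
    · have hτ : V / √(Real.log n) * √(Real.log n) = V := div_mul_cancel₀ _ hsqrt.ne'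
      refine le_trans (ENNReal.ofReal_le_ofReal ?_)
        (TreeFlow.minimaxRisk_ge_of_large hG r (ε := 1 / 2) (τ := V / √(Real.log n)) (V := V)
          (by norm_num) (by norm_num) hn (by positivity) ((div_le_iff₀ hsqrt).2 hVσ) hτ.le ?_)
      · have h1 : (131072 / 200000 : ℝ) ≤ √(1 / 2) :=
          Real.le_sqrt_of_sq_le (by norm_num)
        calc 1 / 200000 * (V ^ 2 / n) = 131072 / 200000 / 131072 * (V ^ 2 / n) := by ring
          _ ≤ √(1 / 2) / 131072 * (V ^ 2 / n) := by gcongr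
          _ = √(1 / 2) / 131072 * (V * (V / √(Real.log n) * √(Real.log n)) / n) := by
              rw [hτ]; ring
          _ = _ := by ring
      · have h1 : (n : ℝ) ^ (1 - 1 / 2 : ℝ) = √n := by
          rw [Real.sqrt_eq_rpow]; norm_num
        rw [h1]
        calc V = V / √(Real.log n) * √(Real.log n) := hτ.symm
          _ ≤ _ := by gcongr
    · have hn256 : (n : ℝ) < 256 := by
        by_contra! h
        refine hn ?_
        calc (4 : ℝ) = (256 : ℝ) ^ ((1 / 2 : ℝ) / 2) := by
              rw [show (256 : ℝ) = 4 ^ (4 : ℝ) by norm_num, ← Real.rpow_mul (by norm_num)]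
              norm_num
          _ ≤ _ := Real.rpow_le_rpow (by norm_num) h (by norm_num)
      have hlog : Real.log n ≤ 6 := by
        have h1 : Real.log n ≤ Real.log 256 := Real.log_le_log hnpos hn256.le
        rw [show (256 : ℝ) = 2 ^ 8 by norm_num, Real.log_pow] at h1
        have := Real.log_two_lt_d9
        push_cast at h1
        linarith
      have h5 : √(Real.log n) ≤ 5 / 2 := Real.sqrt_le_iff.2 ⟨by norm_num, by linarith⟩
      refine le_trans (ENNReal.ofReal_le_ofReal ?_)
        -- `n < 256` forces `V ≤ 5 / 2 * σ`, so `V / 5` is within the allowed `σ / 2`.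
        (TreeFlow.minimaxRisk_ge_of_root G r (b := V / 5) hσ (by positivity) (by nlinarith)
          (by linarith))
      calc 1 / 200000 * (V ^ 2 / n) ≤ 1 / 1600 * (V ^ 2 / n) := by gcongr; norm_num
        _ = _ := by ring
  · have hV0 : 0 < V := lt_of_le_of_lt (by positivity) hV
    by_cases hn : (4 : ℝ) ≤ (n : ℝ) ^ (ε' / 2)
    · refine le_trans (ENNReal.ofReal_le_ofReal ?_)
        (TreeFlow.minimaxRisk_ge_of_large hG r hε' hε'1 hn hσ le_rfl hV.le (hVσ.trans ?_))
      · gcongr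
        exact min_le_left _ _
      · gcongr
        exact min_le_left _ _
    · have hnK : (n : ℝ) ≤ K := by
        by_contra! h
        refine hn ?_
        calc (4 : ℝ) = K ^ (ε' / 2) := by
              rw [hK, ← Real.rpow_mul (by norm_num), show 2 / ε' * (ε' / 2) = 1 by field_simp,
                Real.rpow_one]
          _ ≤ _ := Real.rpow_le_rpow hKpos.le h.le (by positivity)
      rcases (Nat.one_le_iff_ne_zero.2 r.pos.ne').eq_or_lt with h1 | h2
      -- For `n = 1` the logarithm vanishes and the bound is trivial.
      · simp [← h1]
      have hlog : (1 / 2 : ℝ) ≤ √(Real.log n) := by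
        refine Real.le_sqrt_of_sq_le ?_
        have h1 := Real.log_two_gt_d9
        have h3 : Real.log 2 ≤ Real.log n := Real.log_le_log (by norm_num) (by exact_mod_cast h2)
        norm_num
        linarith
      have hVK : V ≤ σ * K := by
        refine hVσ.trans ?_
        gcongr
        calc (n : ℝ) ^ (1 - ε) ≤ (n : ℝ) ^ (1 : ℝ) :=
              Real.rpow_le_rpow_of_exponent_le hn1 (by linarith)
          _ = n := Real.rpow_one _
          _ ≤ K := hnK
      have hsK : √(Real.log n) ≤ K := by
        refine (Real.sqrt_le_iff.2 ⟨hnpos.le, ?_⟩).trans hnK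
        nlinarith
      refine le_trans (ENNReal.ofReal_le_ofReal ?_)
        (TreeFlow.minimaxRisk_ge_of_root G r (b := σ / 2) hσ (by positivity) le_rfl (by nlinarith))
      calc _ ≤ 1 / (256 * K ^ 2) * (σ * K * σ * (K / n)) := by
            gcongr
            exact min_le_right _ _
        _ = (σ / 2) ^ 2 / 64 / n := by field_simp; norm_num
  · obtain ⟨L, hL⟩ := TreeFlow.exists_isRootPaths hG r
    refine le_trans (ENNReal.ofReal_le_ofReal ?_) (hL.minimaxRisk_ge_of_cube hσ hV.le)
    nlinarith [sq_nonneg σ]
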